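/- Let $T\ge 0$ be an integer, let $S_0,\dots,S_T$ be Polish spaces with their Borel $\sigma$-algebras, and let $S=S_0\times\cdots\times S_T$. Let $\psi_t:S_t\to[1,\infty)$ be continuous and put $\psi(s)=\sum_{t=0}^T\psi_t(s_t)$. Let $C_t$ be the Banach space of continuous functions $x_t:S_t\to\mathbb R$ with $x_t/\psi_t$ bounded, with norm $\|x_t\|=\sup|x_t/\psi_t|$, and let $C_t^*$ be its norm dual. Let $M_t\subset C_t^*$ be the set of functionals $x_t\mapsto\int x_t\,d\nu$, where $\nu$ is a finite signed Borel measure on $S_t$ with $\int\psi_t\,d|\nu|<\infty$. Let $\mathcal P$ be the set of Borel probability measures $\lambda$ on $S$ with $\int_S\psi\,d\lambda<\infty$. For $\lambda\in\mathcal P$ denote by $\lambda_t$ its marginal on $S_t$, regarded as an element of $M_t$. Let $R\in\mathcal P$. For each $t$ let $G_t:C_t\to(-\infty,\infty]$ be proper, convex and lower semicontinuous, with domain $\operatorname{dom}G_t=\{G_t<\infty\}$ and conjugate $$G_t^*(\ell)=\sup_{x_t\in C_t}\{\ell(x_t)-G_t(x_t)\},\qquad \ell\in C_t^* .$$ Assume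 that for each $t$ at least one of the following holds: (a) $\int_S e^{c\,\psi_t(s_t)}\,dR(s)<\infty$ for every $c\in\mathbb R$ (which is automatic if $\psi_t$ is bounded); (b) $\operatorname{dom}G_t^*\subseteq M_t$. Assume also that there exist $x_t\in\operatorname{dom}G_t$, $t=0,\dots,T$, and $\varepsilon>0$ with $\sum_{t=0}^Tx_t(s_t)\ge\varepsilon\psi(s)$ for all $s\in S$. Then the generalized Schrödinger problem $$\text{minimize}\quad \sum_{t=0}^TG_t^*(\lambda_t)+\int_S\ln\frac{d\lambda}{dR}\,d\lambda\quad\text{over }\lambda\in\mathcal P\text{ with }\lambda\ll R$$ attains its optimum, and its optimal value (in $[-\infty,\infty]$) equals $$-\inf_{x\in\prod_{t=0}^TC_t}\Big\{\sum_{t=0}^TG_t(x_t)+\ln\int_S\exp\Big(-\sum_{t=0}^Tx_t(s_t)\Big)dR(s)\Big\},$$ where $\ln\infty=\infty$. -/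

import Mathlib

open MeasureTheory

noncomputable section

namespace Schrodinger

/-- A continuous scaling function `X → [1, ∞)`. -/
structure Weight (X : Type*) [TopologicalSpace X] where
  toFun : X → ℝ
  continuous_toFun : Continuous toFun
  one_le : ∀ s, 1 ≤ toFun s

instance {X : Type*} [TopologicalSpace X] : CoeFun (Weight X) (fun _ => X → ℝ) :=
  ⟨Weight.toFun⟩

/-- The continuous functions `x` for which `x / w` is bounded, as a linear space of functions. -/
def weightedSubmodule {X : Type*} [TopologicalSpace X] (w : Weight X) : Submodule ℝ (X → ℝ) where
  carrier := {x | Continuous x ∧ ∃ K : ℝ, ∀ s, |x s / w s| ≤ K}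
  zero_mem' := ⟨continuous_const, 0, by simp⟩
  add_mem' := by
    rintro x y ⟨hx, K, hK⟩ ⟨hy, L, hL⟩
    refine ⟨hx.add hy, K + L, fun s => ?_⟩
    rw [Pi.add_apply, add_div]
    exact (abs_add_le _ _).trans (add_le_add (hK s) (hL s))
  smul_mem' := by
    rintro c x ⟨hx, K, hK⟩
    refine ⟨hx.const_smul c, |c| * K, fun s => ?_⟩
    rw [Pi.smul_apply, smul_eq_mul, mul_div_assoc, abs_mul]
    exact mul_le_mul_of_nonneg_left (hK s) (abs_nonneg c)

/-- The Banach space of continuous `x : X → ℝ` with `x / w` bounded;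
its norm is `‖x‖ = sup_s |x s / w s|`, see the instance below. -/
def WCont {X : Type*} [TopologicalSpace X] (w : Weight X) : Type _ := weightedSubmodule w

section WCont

variable {X : Type*} [TopologicalSpace X] {w : Weight X}

instance : CoeFun (WCont w) (fun _ => X → ℝ) := ⟨fun x => x.1⟩

instance : AddCommGroup (WCont w) := inferInstanceAs (AddCommGroup (weightedSubmodule w))

instance : Module ℝ (WCont w) := inferInstanceAs (Module ℝ (weightedSubmodule w))

theorem Weight.pos (w : Weight X) (s : X) : 0 < w s := zero_lt_one.trans_le (w.one_le s)

theorem WCont.continuous (x : WCont w) : Continuous x := x.2.1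

@[simp] theorem WCont.add_apply (x y : WCont w) (s : X) : (x + y) s = x s + y s := rfl

@[simp] theorem WCont.smul_apply (c : ℝ) (x : WCont w) (s : X) : (c • x) s = c * x s := rfl

/-- The linear map `x ↦ x / w` into the bounded continuous functions. -/
def WCont.scale : WCont w →ₗ[ℝ] BoundedContinuousFunction X ℝ where
  toFun x := BoundedContinuousFunction.ofNormedAddCommGroup (fun s => x s / w s)
    (x.continuous.div w.continuous_toFun (fun s => (w.pos s).ne')) x.2.2.choose
    x.2.2.choose_spec
  map_add' x y := by
    ext s
    exact add_div (x s) (y s) (w s)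
  map_smul' c x := by
    ext s
    exact mul_div_assoc c (x s) (w s)

@[simp] theorem WCont.scale_apply (x : WCont w) (s : X) : WCont.scale x s = x s / w s := rfl

theorem WCont.scale_injective : Function.Injective (WCont.scale (w := w)) := by
  intro x y h
  refine Subtype.ext (funext fun s => ?_)
  have h1 : WCont.scale x s = WCont.scale y s := by rw [h]
  exact (div_left_inj' (w.pos s).ne').1 h1

/-- The norm is `‖x‖ = ‖x / w‖`, with the supremum norm on the right. -/
instance : NormedAddCommGroup (WCont w) :=
  NormedAddCommGroup.induced (WCont w) (BoundedContinuousFunction X ℝ) WCont.scale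
    WCont.scale_injective

theorem WCont.norm_def (x : WCont w) : ‖x‖ = ‖WCont.scale x‖ := rfl

instance : NormedSpace ℝ (WCont w) where
  norm_smul_le c x := by
    rw [WCont.norm_def, WCont.norm_def, map_smul]
    exact norm_smul_le c (WCont.scale x)

theorem WCont.abs_apply_le (x : WCont w) (s : X) : |x s| ≤ ‖x‖ * w s := by
  have h : |x s / w s| ≤ ‖x‖ := (WCont.scale x).norm_coe_le_norm s
  rwa [abs_div, abs_of_pos (w.pos s), div_le_iff₀ (w.pos s)] at h

end WCont

/-! ### Convex analysis on a real normed space -/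

section Convex

variable {E : Type*} [NormedAddCommGroup E] [NormedSpace ℝ E]

/-- Proper convex lower semicontinuous functions with values in `(-∞, ∞]`. -/
structure IsProperConvexLsc (G : E → EReal) : Prop where
  ne_bot : ∀ x, G x ≠ ⊥
  exists_ne_top : ∃ x, G x ≠ ⊤
  convex : ∀ x y : E, ∀ a b : ℝ, 0 < a → 0 < b → a + b = 1 →
    G (a • x + b • y) ≤ (a : EReal) * G x + (b : EReal) * G y
  lsc : LowerSemicontinuous G

/-- The convex conjugate `G*(ℓ) = sup_x (⟨x, ℓ⟩ - G x)` on the norm dual. -/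
def conjugate (G : E → EReal) (ℓ : StrongDual ℝ E) : EReal :=
  ⨆ x : E, (((ℓ x : ℝ) : EReal) - G x)

end Convex

/-! ### Measures that integrate the weight -/

section Measures

variable {X : Type*} [TopologicalSpace X] [MeasurableSpace X] [BorelSpace X]

/-- A probability measure on `X` under which the weight `w` is integrable. -/
structure WProb (w : Weight X) where
  toMeasure : Measure X
  isProb : IsProbabilityMeasure toMeasure
  integrable_weight : Integrable w toMeasure

theorem WCont.integrable {w : Weight X} (x : WCont w) {μ : Measure X} (h : Integrable w μ) :
    Integrable x μ := by
  refine (h.const_mul ‖x‖).mono' x.continuous.aestronglyMeasurable ?_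
  exact Filter.Eventually.of_forall fun s => x.abs_apply_le s

/-- The continuous linear functional `x ↦ ∫ x dp`. -/
def WProb.toDual {w : Weight X} (p : WProb w) : StrongDual ℝ (WCont w) :=
  LinearMap.mkContinuous
    { toFun := fun x => ∫ s, x s ∂p.toMeasure
      map_add' := fun x y =>
        integral_add (x.integrable p.integrable_weight) (y.integrable p.integrable_weight)
      map_smul' := fun c x => integral_const_mul c (fun s => x s) }
    (∫ s, w s ∂p.toMeasure)
    (fun x => by
      have h := norm_integral_le_of_norm_le (f := fun s => x s) (p.integrable_weight.const_mul ‖x‖)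
        (Filter.Eventually.of_forall fun s => x.abs_apply_le s)
      rw [integral_const_mul, mul_comm] at h
      exact h)

/-- The functional `ℓ` is integration against a finite signed Borel measure
whose total variation integrates `w`. -/
def IsSignedMeasure {w : Weight X} (ℓ : StrongDual ℝ (WCont w)) : Prop :=
  ∃ ν : SignedMeasure X, Integrable w ν.totalVariation ∧
    ∀ x : WCont w, ℓ x = (∫ s, x s ∂ν.toJordanDecomposition.posPart)
      - (∫ s, x s ∂ν.toJordanDecomposition.negPart)

end Measures

/-! ### Products -/

section Product

variable {T : ℕ} {S : Fin (T + 1) → Type*} [∀ t, TopologicalSpace (S t)]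

/-- The weight `s ↦ ∑ t, ψ t (s t)` on the product space. -/
def sumWeight (ψ : ∀ t, Weight (S t)) : Weight (∀ t, S t) where
  toFun s := ∑ t, ψ t (s t)
  continuous_toFun :=
    continuous_finsetSum _ fun t _ => (ψ t).continuous_toFun.comp (continuous_apply t)
  one_le s := ((ψ 0).one_le (s 0)).trans
    (Finset.single_le_sum (f := fun t => ψ t (s t)) (fun t _ => ((ψ t).pos (s t)).le)
      (Finset.mem_univ 0))

variable [∀ t, PolishSpace (S t)] [∀ t, MeasurableSpace (S t)] [∀ t, BorelSpace (S t)]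

/-- The `t`-th marginal of a probability measure on the product. -/
def WProb.marginal {ψ : ∀ t, Weight (S t)} (p : WProb (sumWeight ψ)) (t : Fin (T + 1)) :
    WProb (ψ t) where
  toMeasure := p.toMeasure.map (fun s => s t)
  isProb := by
    have := p.isProb
    exact Measure.isProbabilityMeasure_map (measurable_pi_apply t).aemeasurable
  integrable_weight := by
    have hc : Continuous fun s : (∀ t, S t) => ψ t (s t) :=
      (ψ t).continuous_toFun.comp (continuous_apply t)
    rw [integrable_map_measure (ψ t).continuous_toFun.aestronglyMeasurable
      (measurable_pi_apply t).aemeasurable]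
    refine p.integrable_weight.mono' hc.aestronglyMeasurable
      (Filter.Eventually.of_forall fun s => ?_)
    rw [Function.comp_apply, Real.norm_eq_abs, abs_of_pos ((ψ t).pos (s t))]
    exact Finset.single_le_sum (f := fun t => ψ t (s t)) (fun t _ => ((ψ t).pos (s t)).le)
      (Finset.mem_univ t)

/-- The objective `∑ t, G_t*(λ_t) + ∫ ln (dλ/dR) dλ` of the generalized Schrödinger problem. For
probability measures `λ ≪ R`, the Kullback-Leibler divergence is `∫ ln (dλ/dR) dλ ∈ [0, ∞]`. -/
def schrodingerObjective {ψ : ∀ t, Weight (S t)} (G : ∀ t, WCont (ψ t) → EReal)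
    (R : WProb (sumWeight ψ)) (p : WProb (sumWeight ψ)) : EReal :=
  (∑ t, conjugate (G t) (p.marginal t).toDual)
    + ((InformationTheory.klDiv p.toMeasure R.toMeasure : ENNReal) : EReal)

/-- The objective `∑ t, G_t(x_t) + ln ∫ exp (-∑ t, x_t) dR`, the logarithm being `∞` when the
integral is infinite. -/
def potentialObjective {ψ : ∀ t, Weight (S t)} (G : ∀ t, WCont (ψ t) → EReal)
    (R : WProb (sumWeight ψ)) (x : ∀ t, WCont (ψ t)) : EReal :=
  (∑ t, G t (x t))
    + ENNReal.log (lintegral R.toMeasure fun s => ENNReal.ofReal (Real.exp (-∑ t, x t (s t))))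

end Product

end Schrodinger

end

/-!
Weak duality is the Gibbs variational inequality
`∫ u dq - log ∫ exp u dR ≤ KL(q | R)` applied to `u = -∑ t, x t`
(`integral_sub_log_integral_exp_le_klDiv`). When the dual infimum is `-∞` this already settles the
claim, with `R` itself as a minimizer.

Suppose the dual infimum is a real number `v`. On the space of measurable functions on the product
that are dominated by the weight, consider the convex set built from the epigraph of
`u ↦ log ∫ exp u dR` and from `dom G`. Since some `x` in the domain satisfies `∑ t, x t ≥ ε ψ`, this
set absorbs every dominated function, so M. Riesz's extension theorem for cones separates without
any topology (`exists_linearMap_nonneg_of_convex`). The outcome (`exists_isEntropic`) is a linear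
functional `Λ` on dominated functions and a constant `K` with `Λ u ≤ log ∫ exp u dR + K` for all `u`,
and with `∑ t, G_t*(Λ_t) ≤ -v - K`, where `Λ_t x = Λ (x ∘ eval t)`.

The first bound (`IsEntropic`) makes `Λ` positive, normalized and order continuous along sequences
with uniformly dominated exponential moments: scale `u` by a large constant and let the logarithm
tend to zero. Hence `A ↦ Λ 1_A` is a probability measure `λ ≪ R`, it integrates the weight, and a
Fatou argument with truncated densities gives `KL(λ | R) ≤ K` (`IsEntropic.klDiv_measure_le`).

What remains is that `Λ_t` equals the `t`-th marginal of `λ` on all of `C_t`. Both agree on bounded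
functions. Under (a) the exponential moments are finite and `Λ` is integration against `λ` by order
continuity (`IsEntropic.apply_eq_integral`). Under (b) the functional `Λ_t` has a finite conjugate
value, so it is given by a signed measure, which is determined by bounded continuous functions
(`IsSignedMeasure.eq_toDual`).
-/

namespace Schrodinger

open Filter Topology Set InformationTheory

/-! ### Separation in a vector space without topology -/

/-- If a convex set `C` in `E × ℝ` meets the line `{0} × ℝ` only in nonnegative values and its
projection absorbs a subspace `Y`, then on `Y` it lies above the graph of `-Λ` for a linear `Λ`. This
is M. Riesz's extension theorem for the cone generated by `C`; the result is extended from `Y` to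
`E` arbitrarily. -/
theorem exists_linearMap_nonneg_of_convex {E : Type*} [AddCommGroup E] [Module ℝ E]
    (Y : Submodule ℝ E) {C : Set (E × ℝ)} (hC : Convex ℝ C)
    (h0 : ∀ a : ℝ, ((0 : E), a) ∈ C → 0 ≤ a)
    (habs : ∀ y ∈ Y, ∃ c : ℝ, 0 < c ∧ ∃ a : ℝ, (c • y, a) ∈ C) :
    ∃ Λ : E →ₗ[ℝ] ℝ, ∀ y ∈ Y, ∀ a : ℝ, (y, a) ∈ C → 0 ≤ Λ y + a := by
  have hC' : ∀ y ∈ C, ∀ z ∈ C, ∀ a b : ℝ, 0 ≤ a → 0 ≤ b → a + b = 1 → a • y + b • z ∈ C :=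
    fun y hy z hz a b ha hb hab => hC hy hz ha hb hab
  -- The cone generated by `C`, restricted to `Y × ℝ`; the scalar `c = 0` supplies the origin.
  let s : PointedCone ℝ (Y × ℝ) :=
    { carrier := {z | ∃ c : ℝ, 0 ≤ c ∧ ∃ y ∈ C, ((z.1 : E), z.2) = c • y}
      zero_mem' := by
        obtain ⟨c, -, a, ha⟩ := habs 0 Y.zero_mem
        exact ⟨0, le_rfl, _, ha, by simp⟩
      add_mem' := by
        rintro z z' ⟨c, hc, y, hy, h⟩ ⟨c', hc', y', hy', h'⟩
        rcases (add_nonneg hc hc').eq_or_lt with h1 | h1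
        · have hc0 : c = 0 := by linarith
          have hc0' : c' = 0 := by linarith
          refine ⟨0, le_rfl, y, hy, ?_⟩
          have : (((z + z').1 : E), (z + z').2) = ((z.1 : E), z.2) + ((z'.1 : E), z'.2) := rfl
          rw [this, h, h', hc0, hc0']; simp
        · refine ⟨c + c', h1.le, _, hC' y hy y' hy' (c / (c + c')) (c' / (c + c')) (by positivity)
            (by positivity) (by field_simp), ?_⟩
          have : (((z + z').1 : E), (z + z').2) = ((z.1 : E), z.2) + ((z'.1 : E), z'.2) := rfl
          rw [this, h, h', smul_add, smul_smul, smul_smul, mul_div_cancel₀ _ h1.ne',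
            mul_div_cancel₀ _ h1.ne']
      smul_mem' := by
        rintro d z ⟨c, hc, y, hy, h⟩
        refine ⟨d * c, mul_nonneg d.2 hc, y, hy, ?_⟩
        have : (((d • z).1 : E), (d • z).2) = (d : ℝ) • ((z.1 : E), z.2) := rfl
        rw [this, h, smul_smul] }
  have hs : ∀ z : Y × ℝ, z ∈ s ↔ ∃ c : ℝ, 0 ≤ c ∧ ∃ y ∈ C, ((z.1 : E), z.2) = c • y :=
    fun z => Iff.rfl
  let f : (Y × ℝ) →ₗ.[ℝ] ℝ :=
    ⟨LinearMap.ker (LinearMap.fst ℝ Y ℝ), (LinearMap.snd ℝ Y ℝ).comp (Submodule.subtype _)⟩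
  obtain ⟨g, hg, hgs⟩ := riesz_extension s f (by
    rintro ⟨⟨y, a⟩, hy⟩ hz
    obtain rfl : y = 0 := hy
    obtain ⟨c, hc, ⟨y', a'⟩, hy', h⟩ := (hs _).1 hz
    change 0 ≤ a
    simp only [Prod.smul_mk, Prod.mk.injEq, smul_eq_mul, ZeroMemClass.coe_zero] at h
    rcases hc.eq_or_lt with rfl | hc
    · simp [h.2]
    · have : y' = 0 := ((smul_eq_zero.1 h.1.symm).resolve_left hc.ne')
      subst this
      rw [h.2]
      exact mul_nonneg hc.le (h0 _ hy')) (by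
    rintro ⟨y, b⟩
    obtain ⟨c, hc, a, ha⟩ := habs y y.2
    refine ⟨⟨((0 : Y), a / c - b), rfl⟩, (hs _).2 ⟨c⁻¹, by positivity, _, ha, ?_⟩⟩
    simp only [Prod.mk_add_mk, zero_add, Prod.smul_mk, Prod.mk.injEq, smul_smul, smul_eq_mul]
    rw [inv_mul_cancel₀ hc.ne', one_smul]
    exact ⟨rfl, by ring⟩)
  obtain ⟨Λ, hΛ⟩ := LinearMap.exists_extend (g.comp (LinearMap.inl ℝ Y ℝ))
  refine ⟨Λ, fun y hy a ha => ?_⟩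
  have h1 : Λ y = g (⟨y, hy⟩, 0) := LinearMap.congr_fun hΛ ⟨y, hy⟩
  have h2 : g ((0 : Y), a) = a := hg ⟨((0 : Y), a), rfl⟩
  have h3 := hgs (⟨y, hy⟩, a) ((hs _).2 ⟨1, zero_le_one, _, ha, by simp⟩)
  have h4 : ((⟨y, hy⟩, a) : Y × ℝ) = (⟨y, hy⟩, 0) + (0, a) := by simp
  rw [h4, map_add, h2, ← h1] at h3
  exact h3

/-- A bound on `∑ i, b i` over all independent choices `b i ∈ B i` bounds each `B i`, as the other
coordinates can be kept fixed, and passes to the sum of the suprema. -/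
theorem bddAbove_and_sum_csSup_le {ι : Type*} [Fintype ι] {B : ι → Set ℝ}
    (hne : ∀ i, (B i).Nonempty) {M : ℝ}
    (h : ∀ b : ι → ℝ, (∀ i, b i ∈ B i) → ∑ i, b i ≤ M) :
    (∀ i, BddAbove (B i)) ∧ ∑ i, sSup (B i) ≤ M := by
  classical
  constructor
  · intro i
    choose b₀ hb₀ using hne
    refine ⟨M - ∑ j ∈ Finset.univ.erase i, b₀ j, fun y hy => ?_⟩
    have h1 := h (Function.update b₀ i y) (fun j => by
      by_cases hj : j = i
      · subst hj; simpa using hy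
      · simpa [hj] using hb₀ j)
    rw [← Finset.add_sum_erase _ _ (Finset.mem_univ i), Function.update_self] at h1
    have h2 : ∑ j ∈ Finset.univ.erase i, Function.update b₀ i y j
        = ∑ j ∈ Finset.univ.erase i, b₀ j :=
      Finset.sum_congr rfl fun j hj => Function.update_of_ne (Finset.ne_of_mem_erase hj) _ _
    rw [h2] at h1
    linarith
  · refine le_of_forall_pos_le_add fun δ hδ => ?_
    set n : ℝ := Fintype.card ι + 1
    have hn : 0 < n := by positivity
    have : ∀ i, ∃ b ∈ B i, sSup (B i) - δ / n < b := fun i =>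
      exists_lt_of_lt_csSup (hne i) (by linarith [div_pos hδ hn])
    choose b hb hb' using this
    have h1 : ∑ i, sSup (B i) ≤ ∑ i, (b i + δ / n) :=
      Finset.sum_le_sum fun i _ => by linarith [hb' i]
    rw [Finset.sum_add_distrib, Finset.sum_const, nsmul_eq_mul, Finset.card_univ] at h1
    have h2 : (Fintype.card ι : ℝ) * (δ / n) ≤ δ := by
      rw [mul_div_assoc', div_le_iff₀ hn]
      have : (Fintype.card ι : ℝ) ≤ n := by simp [n]
      nlinarith
    linarith [h b hb]

/-! ### Linear functionals dominated by a log-moment generating function -/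

section Functional

variable {Ω : Type*} [MeasurableSpace Ω]

/-- Measurable real functions bounded by a multiple of `w`. -/
def dominatedSubmodule (w : Ω → ℝ) : Submodule ℝ (Ω → ℝ) where
  carrier := {u | Measurable u ∧ ∃ C : ℝ, ∀ s, |u s| ≤ C * w s}
  zero_mem' := ⟨measurable_const, 0, by simp⟩
  add_mem' := by
    rintro x y ⟨hx, K, hK⟩ ⟨hy, L, hL⟩
    refine ⟨hx.add hy, K + L, fun s => ?_⟩
    rw [Pi.add_apply, add_mul]
    exact (abs_add_le _ _).trans (add_le_add (hK s) (hL s))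
  smul_mem' := by
    rintro c x ⟨hx, K, hK⟩
    refine ⟨hx.const_smul c, |c| * K, fun s => ?_⟩
    rw [Pi.smul_apply, smul_eq_mul, mul_assoc, abs_mul]
    exact mul_le_mul_of_nonneg_left (hK s) (abs_nonneg c)

theorem mem_dominatedSubmodule_of_abs_le {w u : Ω → ℝ} (hw : ∀ s, 1 ≤ w s) (hu : Measurable u)
    {M : ℝ} (hM : ∀ s, |u s| ≤ M) : u ∈ dominatedSubmodule w :=
  ⟨hu, M, fun s => (hM s).trans (le_mul_of_one_le_right ((abs_nonneg _).trans (hM s)) (hw s))⟩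

/-- `Λ u ≤ log ∫ exp u dR + K` for all `w`-dominated measurable `u`. The logarithm is expressed
through the constants `r` with `∫ exp (u - r) dR ≤ 1`, which also covers infinite integrals.
`Λ` is defined on all functions for convenience; only its values on dominated ones matter. -/
structure IsEntropic (w : Ω → ℝ) (ρ : Measure Ω) (K : ℝ) (Λ : (Ω → ℝ) →ₗ[ℝ] ℝ) : Prop where
  one_le : ∀ s, 1 ≤ w s
  le : ∀ u ∈ dominatedSubmodule w, ∀ r : ℝ,
    ∫⁻ s, ENNReal.ofReal (Real.exp (u s - r)) ∂ρ ≤ 1 → Λ u ≤ r + K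

namespace IsEntropic

variable {w : Ω → ℝ} {ρ : Measure Ω} {K : ℝ} {Λ : (Ω → ℝ) →ₗ[ℝ] ℝ}

theorem const_mem (h : IsEntropic w ρ K Λ) (c : ℝ) : (fun _ => c) ∈ dominatedSubmodule w :=
  mem_dominatedSubmodule_of_abs_le h.one_le measurable_const fun _ => le_rfl

theorem indicator_mem (h : IsEntropic w ρ K Λ) {A : Set Ω} (hA : MeasurableSet A) :
    A.indicator (fun _ => (1 : ℝ)) ∈ dominatedSubmodule w :=
  mem_dominatedSubmodule_of_abs_le h.one_le (measurable_const.indicator hA) (M := 1) fun s => by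
    by_cases hs : s ∈ A <;> simp [hs]

theorem simpleFunc_mem (h : IsEntropic w ρ K Λ) (f : SimpleFunc Ω ℝ) :
    (f : Ω → ℝ) ∈ dominatedSubmodule w := by
  obtain ⟨M, hM⟩ := f.exists_forall_norm_le
  exact mem_dominatedSubmodule_of_abs_le h.one_le f.measurable hM

variable [IsProbabilityMeasure ρ]

theorem le_of_ae_le (h : IsEntropic w ρ K Λ) {u : Ω → ℝ} (hu : u ∈ dominatedSubmodule w) {r : ℝ}
    (hr : ∀ᵐ s ∂ρ, u s ≤ r) : Λ u ≤ r + K := by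
  refine h.le u hu r ?_
  calc ∫⁻ s, ENNReal.ofReal (Real.exp (u s - r)) ∂ρ ≤ ∫⁻ _, 1 ∂ρ := by
        refine lintegral_mono_ae (hr.mono fun s hs => ?_)
        rw [ENNReal.ofReal_le_one, Real.exp_le_one_iff]
        linarith
    _ = 1 := by simp

theorem const_nonneg (h : IsEntropic w ρ K Λ) : 0 ≤ K := by
  have := h.le_of_ae_le (u := 0) (Submodule.zero_mem _) (r := 0) (by simp)
  simpa using this

/-- Scaling `u` by arbitrarily large constants turns the bound `Λ u ≤ K` into `Λ u ≤ 0`. -/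
theorem nonpos_of_ae_nonpos (h : IsEntropic w ρ K Λ) {u : Ω → ℝ} (hu : u ∈ dominatedSubmodule w)
    (hr : ∀ᵐ s ∂ρ, u s ≤ 0) : Λ u ≤ 0 := by
  by_contra! hneg
  have h1 := h.le_of_ae_le (u := ((K + 1) / Λ u) • u) (Submodule.smul_mem _ _ hu) (r := 0)
    (hr.mono fun s hs => mul_nonpos_of_nonneg_of_nonpos
      (div_nonneg (by linarith [h.const_nonneg]) hneg.le) hs)
  rw [map_smul, smul_eq_mul, div_mul_cancel₀ _ hneg.ne'] at h1
  linarith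

theorem mono_ae (h : IsEntropic w ρ K Λ) {u v : Ω → ℝ} (hu : u ∈ dominatedSubmodule w)
    (hv : v ∈ dominatedSubmodule w) (huv : ∀ᵐ s ∂ρ, u s ≤ v s) : Λ u ≤ Λ v := by
  have := h.nonpos_of_ae_nonpos (Submodule.sub_mem _ hu hv)
    (huv.mono fun s hs => sub_nonpos.2 hs)
  rw [map_sub] at this
  linarith

theorem nonneg (h : IsEntropic w ρ K Λ) {u : Ω → ℝ} (hu : u ∈ dominatedSubmodule w)
    (h0 : ∀ s, 0 ≤ u s) : 0 ≤ Λ u := by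
  simpa using h.mono_ae (Submodule.zero_mem _) hu (Eventually.of_forall h0)

theorem abs_apply_le (h : IsEntropic w ρ K Λ) {u v : Ω → ℝ} (hu : u ∈ dominatedSubmodule w)
    (hv : v ∈ dominatedSubmodule w) (huv : ∀ s, |u s| ≤ v s) : |Λ u| ≤ Λ v := by
  rw [abs_le']
  refine ⟨h.mono_ae hu hv (Eventually.of_forall fun s => (abs_le'.1 (huv s)).1), ?_⟩
  rw [← map_neg]
  exact h.mono_ae (Submodule.neg_mem _ hu) hv (Eventually.of_forall fun s => (abs_le'.1 (huv s)).2)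

/-- The dominating functional is translation-equivariant, which forces total mass one. -/
theorem apply_one (h : IsEntropic w ρ K Λ) : Λ (fun _ => 1) = 1 := by
  have key : ∀ c : ℝ, c * (Λ (fun _ => 1) - 1) ≤ K := fun c => by
    have h1 := h.le_of_ae_le (u := c • fun _ => 1) (Submodule.smul_mem _ _ (h.const_mem 1)) (r := c)
      (by simp)
    rw [map_smul, smul_eq_mul] at h1
    linarith
  by_contra hne
  have h1 := key ((K + 1) / (Λ (fun _ => 1) - 1))
  rw [div_mul_cancel₀ _ (sub_ne_zero.2 hne)] at h1
  linarith

/-- Order continuity: `c * Λ (v n) ≤ log ∫ exp (c * v n) dR + K`, and by dominated convergence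
the logarithm tends to zero for every `c`. -/
theorem tendsto_zero (h : IsEntropic w ρ K Λ) {v : ℕ → Ω → ℝ} {g : Ω → ℝ}
    (hv : ∀ n, v n ∈ dominatedSubmodule w) (h0 : ∀ n s, 0 ≤ v n s) (hvg : ∀ n s, v n s ≤ g s)
    (hg : ∀ c : ℝ, Integrable (fun s => Real.exp (c * g s)) ρ)
    (hlim : ∀ s, Tendsto (fun n => v n s) atTop (𝓝 0)) :
    Tendsto (fun n => Λ (v n)) atTop (𝓝 0) := by
  rw [Metric.tendsto_atTop']
  intro δ hδ
  have hK := h.const_nonneg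
  set c : ℝ := (K + 2) / δ with hc
  have hcpos : 0 < c := by positivity
  have hT : Tendsto (fun n => ∫⁻ s, ENNReal.ofReal (Real.exp ((c • v n) s - 1)) ∂ρ) atTop
      (𝓝 (∫⁻ _, ENNReal.ofReal (Real.exp (-1)) ∂ρ)) := by
    refine tendsto_lintegral_of_dominated_convergence
      (fun s => ENNReal.ofReal (Real.exp (c * g s))) (fun n => ?_) (fun n => ?_) ?_ ?_
    · have := (hv n).1
      simp only [Pi.smul_apply, smul_eq_mul]
      fun_prop
    · refine Eventually.of_forall fun s => ENNReal.ofReal_le_ofReal (Real.exp_le_exp.2 ?_)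
      have := mul_le_mul_of_nonneg_left (hvg n s) hcpos.le
      simp only [Pi.smul_apply, smul_eq_mul]
      linarith
    · exact (hg c).lintegral_lt_top.ne
    · refine Eventually.of_forall fun s => ENNReal.tendsto_ofReal
        ((Real.continuous_exp.tendsto _).comp ?_)
      have := ((hlim s).const_mul c).sub_const 1
      simpa using this
  have hlt : ∫⁻ _, ENNReal.ofReal (Real.exp (-1)) ∂ρ < 1 := by
    simp only [lintegral_const, measure_univ, mul_one]
    rw [ENNReal.ofReal_lt_one, Real.exp_lt_one_iff]
    norm_num
  obtain ⟨N, hN⟩ := eventually_atTop.1 (hT.eventually_lt_const hlt)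
  refine ⟨N, fun n hn => ?_⟩
  have h1 := h.le _ (Submodule.smul_mem _ c (hv n)) 1 (hN n hn.le).le
  rw [map_smul, smul_eq_mul] at h1
  have h2 := h.nonneg (hv n) (h0 n)
  rw [Real.dist_eq, sub_zero, abs_of_nonneg h2]
  have h3 : c * δ = K + 2 := div_mul_cancel₀ _ hδ.ne'
  by_contra! h4
  have := mul_le_mul_of_nonneg_left h4 hcpos.le
  linarith

/-- Countable additivity: the tails of a disjoint union decrease to the empty set, so order
continuity applies to their indicators. -/
theorem hasSum_indicator (h : IsEntropic w ρ K Λ) {A : ℕ → Set Ω} (hA : ∀ i, MeasurableSet (A i))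
    (hd : Pairwise (Function.onFun Disjoint A)) :
    HasSum (fun i => Λ ((A i).indicator fun _ => 1)) (Λ ((⋃ i, A i).indicator fun _ => 1)) := by
  have hnn : ∀ i, 0 ≤ Λ ((A i).indicator fun _ => 1) := fun i =>
    h.nonneg (h.indicator_mem (hA i)) fun s => indicator_nonneg (fun _ _ => zero_le_one) s
  rw [hasSum_iff_tendsto_nat_of_nonneg hnn]
  have hsplit : ∀ n, (⋃ i, A i).indicator (fun _ => (1 : ℝ))
      = ∑ i ∈ Finset.range n, (A i).indicator (fun _ => (1 : ℝ))
        + (⋃ i, ⋃ _ : n ≤ i, A i).indicator fun _ => (1 : ℝ) := by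
    intro n
    have h1 : ∑ i ∈ Finset.range n, (A i).indicator (fun _ => (1 : ℝ))
        = (⋃ i ∈ Finset.range n, A i).indicator fun _ => (1 : ℝ) := by
      rw [Finset.indicator_biUnion _ _ fun i _ j _ hij => hd hij]
      ext s
      simp
    rw [h1]
    refine Eq.trans ?_ (indicator_union_of_disjoint ?_ _)
    · congr 1
      ext s
      simp only [mem_iUnion, mem_union, Finset.mem_range, exists_prop]
      constructor
      · rintro ⟨i, hi⟩
        rcases lt_or_ge i n with hin | hin
        exacts [Or.inl ⟨i, hin, hi⟩, Or.inr ⟨i, hin, hi⟩]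
      · rintro (⟨i, -, hi⟩ | ⟨i, -, hi⟩) <;> exact ⟨i, hi⟩
    · rw [Set.disjoint_left]
      simp only [mem_iUnion, Finset.mem_range, exists_prop]
      rintro s ⟨i, hi, his⟩ ⟨j, hj, hjs⟩
      exact Set.disjoint_left.1 (hd (by omega : i ≠ j)) his hjs
  have hlim := h.tendsto_zero
    (v := fun n => (⋃ i, ⋃ _ : n ≤ i, A i).indicator fun _ => (1 : ℝ)) (g := fun _ => 1)
    (fun n => h.indicator_mem (MeasurableSet.iUnion fun i => MeasurableSet.iUnion fun _ => hA i))
    (fun n s => indicator_nonneg (fun _ _ => zero_le_one) s)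
    (fun n s => indicator_le_self' (fun _ _ => zero_le_one) s) (fun c => integrable_const _)
    (fun s => by
      by_cases hs : ∃ j, s ∈ A j
      · obtain ⟨j, hj⟩ := hs
        refine tendsto_const_nhds.congr' ?_
        filter_upwards [eventually_gt_atTop j] with n hn
        symm
        refine indicator_of_notMem ?_ _
        simp only [mem_iUnion, exists_prop, not_exists, not_and]
        intro i hi his
        exact Set.disjoint_left.1 (hd (by omega : i ≠ j)) his hj
      · push Not at hs
        refine tendsto_const_nhds.congr fun n => ?_
        symm
        exact indicator_of_notMem (by simp [hs]) _)
  have h2 := hlim.const_sub (Λ ((⋃ i, A i).indicator fun _ => 1))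
  rw [sub_zero] at h2
  refine h2.congr fun n => ?_
  rw [hsplit n, map_add, map_sum]
  ring

/-- The measure `A ↦ Λ 1_A`. -/
noncomputable def measure (h : IsEntropic w ρ K Λ) : Measure Ω :=
  Measure.ofMeasurable (fun A _ => ENNReal.ofReal (Λ (A.indicator fun _ => 1)))
    (by
      simp only [indicator_empty]
      rw [show (fun _ : Ω => (0 : ℝ)) = 0 from rfl, map_zero, ENNReal.ofReal_zero])
    (fun A hA hd => by
      have hs := h.hasSum_indicator hA hd
      rw [← hs.tsum_eq, ENNReal.ofReal_tsum_of_nonneg (fun i => h.nonneg (h.indicator_mem (hA i))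
        fun s => indicator_nonneg (fun _ _ => zero_le_one) s) hs.summable])

theorem measure_apply (h : IsEntropic w ρ K Λ) {A : Set Ω} (hA : MeasurableSet A) :
    h.measure A = ENNReal.ofReal (Λ (A.indicator fun _ => 1)) :=
  Measure.ofMeasurable_apply A hA

instance isProbabilityMeasure_measure (h : IsEntropic w ρ K Λ) :
    IsProbabilityMeasure h.measure :=
  ⟨by rw [h.measure_apply .univ, indicator_univ, h.apply_one, ENNReal.ofReal_one]⟩

theorem measure_absolutelyContinuous (h : IsEntropic w ρ K Λ) : h.measure ≪ ρ := by
  refine Measure.AbsolutelyContinuous.mk fun A hA hρA => ?_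
  rw [h.measure_apply hA, ENNReal.ofReal_eq_zero]
  refine h.nonpos_of_ae_nonpos (h.indicator_mem hA) ?_
  filter_upwards [measure_eq_zero_iff_ae_notMem.1 hρA] with s hs
  simp [hs]

theorem apply_simpleFunc (h : IsEntropic w ρ K Λ) (f : SimpleFunc Ω ℝ) :
    Λ f = ∫ s, f s ∂h.measure := by
  induction f using SimpleFunc.induction with
  | @const c A hA =>
    have h1 : ((SimpleFunc.piecewise A hA (SimpleFunc.const Ω c) (SimpleFunc.const Ω 0) :
        SimpleFunc Ω ℝ) : Ω → ℝ) = c • A.indicator fun _ => (1 : ℝ) := by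
      ext s
      by_cases hs : s ∈ A <;> simp [hs]
    rw [h1, map_smul, smul_eq_mul]
    simp only [Pi.smul_apply, smul_eq_mul]
    rw [integral_const_mul, integral_indicator_const _ hA, smul_eq_mul, mul_one, measureReal_def,
      h.measure_apply hA, ENNReal.toReal_ofReal (h.nonneg (h.indicator_mem hA)
        fun s => indicator_nonneg (fun _ _ => zero_le_one) s)]
  | @add f g hd hf hg =>
    rw [SimpleFunc.coe_add, map_add, hf, hg]
    exact (integral_add (f.integrable_of_isFiniteMeasure) (g.integrable_of_isFiniteMeasure)).symm

/-- Only `≤` is claimed: on unbounded `u` the functional may have a singular part. -/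
theorem lintegral_le (h : IsEntropic w ρ K Λ) {u : Ω → ℝ} (hu : u ∈ dominatedSubmodule w)
    (h0 : ∀ s, 0 ≤ u s) : ∫⁻ s, ENNReal.ofReal (u s) ∂h.measure ≤ ENNReal.ofReal (Λ u) := by
  rw [lintegral_eq_nnreal]
  refine iSup₂_le fun φ hφ => ?_
  rw [← SimpleFunc.lintegral_eq_lintegral]
  have h1 := h.apply_simpleFunc (φ.map ((↑) : NNReal → ℝ))
  have h2 : Λ (φ.map ((↑) : NNReal → ℝ)) ≤ Λ u :=
    h.mono_ae (h.simpleFunc_mem _) hu (Eventually.of_forall fun s => by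
      have := ENNReal.toReal_mono ENNReal.ofReal_ne_top (hφ s)
      rwa [ENNReal.toReal_ofReal (h0 s)] at this)
  calc ∫⁻ s, (φ.map ((↑) : NNReal → ENNReal)) s ∂h.measure
      = ENNReal.ofReal (∫ s, (φ.map ((↑) : NNReal → ℝ)) s ∂h.measure) := by
        rw [ofReal_integral_eq_lintegral_ofReal (SimpleFunc.integrable_of_isFiniteMeasure _)
          (Eventually.of_forall fun s => by simp)]
        simp
    _ ≤ ENNReal.ofReal (Λ u) := by
        rw [← h1]
        exact ENNReal.ofReal_le_ofReal h2

theorem integrable (h : IsEntropic w ρ K Λ) {u : Ω → ℝ} (hu : u ∈ dominatedSubmodule w) :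
    Integrable u h.measure := by
  have hu' : (fun s => |u s|) ∈ dominatedSubmodule w := by
    obtain ⟨hm, C, hC⟩ := hu
    exact ⟨hm.abs, C, by simpa using hC⟩
  refine ⟨hu.1.aestronglyMeasurable, ?_⟩
  rw [hasFiniteIntegral_iff_norm]
  exact (h.lintegral_le hu' fun s => abs_nonneg _).trans_lt ENNReal.ofReal_lt_top

/-- On functions all of whose exponential moments under `ρ` are finite, `Λ` has no singular part:
it is integration against its measure. -/
theorem apply_eq_integral (h : IsEntropic w ρ K Λ) {u : Ω → ℝ} (hu : u ∈ dominatedSubmodule w)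
    (hexp : ∀ c : ℝ, Integrable (fun s => Real.exp (c * |u s|)) ρ) :
    Λ u = ∫ s, u s ∂h.measure := by
  let f : ℕ → SimpleFunc Ω ℝ := SimpleFunc.approxOn u hu.1 univ 0 (mem_univ _)
  have hf : ∀ n s, |f n s| ≤ 2 * |u s| := fun n s =>
    (SimpleFunc.norm_approxOn_zero_le hu.1 (mem_univ _) s n).trans_eq (two_mul _).symm
  have hlim : ∀ s, Tendsto (fun n => f n s) atTop (𝓝 (u s)) := fun s =>
    SimpleFunc.tendsto_approxOn hu.1 (mem_univ _) (by simp)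
  have h1 : Tendsto (fun n => ∫ s, f n s ∂h.measure) atTop (𝓝 (∫ s, u s ∂h.measure)) :=
    tendsto_integral_of_dominated_convergence (fun s => 2 * |u s|)
      (fun n => (f n).aestronglyMeasurable) ((h.integrable hu).abs.const_mul 2)
      (fun n => Eventually.of_forall (hf n)) (Eventually.of_forall hlim)
  have hd : ∀ n, (fun s => |f n s - u s|) ∈ dominatedSubmodule w := fun n => by
    obtain ⟨hm, C, hC⟩ := Submodule.sub_mem _ (h.simpleFunc_mem (f n)) hu
    exact ⟨hm.abs, C, by simpa using hC⟩
  have h2 : Tendsto (fun n => Λ fun s => |f n s - u s|) atTop (𝓝 0) := by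
    refine h.tendsto_zero hd (fun n s => abs_nonneg _) (g := fun s => 3 * |u s|)
      (fun n s => ?_) (fun c => ?_) fun s => ?_
    · have := abs_sub (f n s) (u s)
      linarith [hf n s]
    · convert hexp (c * 3) using 3
      ring
    · simpa using ((hlim s).sub_const (u s)).abs
  have h3 : Tendsto (fun n => Λ (f n)) atTop (𝓝 (Λ u)) := by
    rw [tendsto_iff_dist_tendsto_zero]
    refine squeeze_zero (fun _ => dist_nonneg) (fun n => ?_) h2
    rw [Real.dist_eq, ← map_sub]
    exact h.abs_apply_le (Submodule.sub_mem _ (h.simpleFunc_mem _) hu) (hd n) fun s => le_rfl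
  refine tendsto_nhds_unique h3 (h1.congr fun n => (h.apply_simpleFunc (f n)).symm)

theorem apply_eq_integral_of_abs_le (h : IsEntropic w ρ K Λ) {u : Ω → ℝ} (hu : Measurable u)
    {M : ℝ} (hM : ∀ s, |u s| ≤ M) : Λ u = ∫ s, u s ∂h.measure := by
  refine h.apply_eq_integral (mem_dominatedSubmodule_of_abs_le h.one_le hu hM) fun c => ?_
  refine Integrable.of_bound (C := Real.exp (|c| * M)) (by fun_prop)
    (Eventually.of_forall fun s => ?_)
  rw [Real.norm_eq_abs, Real.abs_exp, Real.exp_le_exp]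
  exact (mul_le_mul_of_nonneg_right (le_abs_self c) (abs_nonneg _)).trans
    (mul_le_mul_of_nonneg_left (hM s) (abs_nonneg c))

end IsEntropic

end Functional

/-! ### Entropy bounds -/

/-- Tangent line inequality behind the Gibbs variational principle. -/
theorem mul_log_add_one_sub_le_klFun {f g : ℝ} (hf : 0 ≤ f) (hg : 0 < g) :
    f * Real.log g + 1 - g ≤ klFun f := by
  rw [klFun_apply]
  rcases hf.eq_or_lt with rfl | hf
  · simp [hg.le]
  have h1 := Real.log_le_sub_one_of_pos (div_pos hg hf)
  rw [Real.log_div hg.ne' hf.ne'] at h1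
  have h2 := mul_le_mul_of_nonneg_left h1 hf.le
  have h3 : f * (g / f - 1) = g - f := by field_simp
  rw [h3] at h2
  linarith

section Entropy

variable {Ω : Type*} [MeasurableSpace Ω]

/-- The Gibbs (Donsker-Varadhan) inequality, obtained by integrating the tangent line inequality at
the density `exp u / ∫ exp u dρ`. -/
theorem integral_sub_log_integral_exp_le_klDiv {μ ρ : Measure Ω} [IsProbabilityMeasure μ]
    [IsProbabilityMeasure ρ] (hμ : μ ≪ ρ) (hkl : klDiv μ ρ ≠ ⊤) {u : Ω → ℝ}
    (hu : Integrable u μ) (hexp : Integrable (fun s => Real.exp (u s)) ρ) :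
    ∫ s, u s ∂μ - Real.log (∫ s, Real.exp (u s) ∂ρ) ≤ (klDiv μ ρ).toReal := by
  set Z := ∫ s, Real.exp (u s) ∂ρ with hZ
  have hZpos : 0 < Z := integral_exp_pos hexp
  have hint : Integrable (fun s => klFun (μ.rnDeriv ρ s).toReal) ρ :=
    (integrable_klFun_rnDeriv_iff hμ).2 (klDiv_ne_top_iff.1 hkl).2
  rw [toReal_klDiv_eq_integral_klFun hμ]
  have hfu : Integrable (fun s => (μ.rnDeriv ρ s).toReal * (u s - Real.log Z)) ρ :=
    (integrable_toReal_rnDeriv_mul_iff hμ).2 (hu.sub (integrable_const _))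
  have hfu1 : Integrable (fun s => (μ.rnDeriv ρ s).toReal * (u s - Real.log Z) + 1) ρ :=
    hfu.add (integrable_const 1)
  have h1 : ∫ s, ((μ.rnDeriv ρ s).toReal * (u s - Real.log Z) + 1 - Real.exp (u s) / Z) ∂ρ
      = ∫ s, u s ∂μ - Real.log Z := by
    rw [integral_sub hfu1 (hexp.div_const Z),
      integral_add hfu (integrable_const 1), integral_toReal_rnDeriv_mul hμ,
      integral_sub hu (integrable_const _), integral_div, ← hZ, div_self hZpos.ne']
    simp
  rw [← h1]
  refine integral_mono (hfu1.sub (hexp.div_const Z)) hint fun s => ?_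
  have := mul_log_add_one_sub_le_klFun (f := (μ.rnDeriv ρ s).toReal) ENNReal.toReal_nonneg
    (div_pos (Real.exp_pos (u s)) hZpos)
  rwa [Real.log_div (Real.exp_ne_zero _) hZpos.ne', Real.log_exp] at this

/-- The density is truncated to `[1 / (n + 1), n + 1]`, so that its logarithm is bounded; the
tangent line inequality at the truncation is nonnegative and Fatou's lemma applies. -/
theorem IsEntropic.klDiv_measure_le {w : Ω → ℝ} {ρ : Measure Ω} [IsProbabilityMeasure ρ] {K : ℝ}
    {Λ : (Ω → ℝ) →ₗ[ℝ] ℝ} (h : IsEntropic w ρ K Λ) :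
    klDiv h.measure ρ ≤ ENNReal.ofReal K := by
  have hac := h.measure_absolutelyContinuous
  rw [klDiv_eq_lintegral_klFun_of_ac hac]
  set f : Ω → ℝ := fun s => (h.measure.rnDeriv ρ s).toReal with hf
  have hfm : Measurable f := (Measure.measurable_rnDeriv _ _).ennreal_toReal
  have hf0 : ∀ s, 0 ≤ f s := fun s => ENNReal.toReal_nonneg
  let g : ℕ → Ω → ℝ := fun n s => max (min (f s) (n + 1)) ((n + 1 : ℝ)⁻¹)
  have hgm : ∀ n, Measurable (g n) := fun n => by fun_prop
  have hn0 : ∀ n : ℕ, 0 < (n + 1 : ℝ)⁻¹ := fun n => by positivity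
  have hn1 : ∀ n : ℕ, (n + 1 : ℝ)⁻¹ ≤ 1 := fun n => inv_le_one_of_one_le₀ (by simp)
  have hn2 : ∀ n : ℕ, (1 : ℝ) ≤ n + 1 := fun n => by simp
  have hg1 : ∀ (n : ℕ) s, (n + 1 : ℝ)⁻¹ ≤ g n s := fun n s => le_max_right _ _
  have hg2 : ∀ (n : ℕ) s, g n s ≤ n + 1 := fun n s =>
    max_le (min_le_right _ _) ((hn1 n).trans (hn2 n))
  have hgpos : ∀ n s, 0 < g n s := fun n s => (hn0 n).trans_le (hg1 n s)
  have hlog : ∀ (n : ℕ) s, |Real.log (g n s)| ≤ Real.log (n + 1) := fun n s => by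
    rw [abs_le]
    constructor
    · rw [← Real.log_inv]
      exact Real.log_le_log (hn0 n) (hg1 n s)
    · exact Real.log_le_log (hgpos n s) (hg2 n s)
  -- The tangent line to `klFun` at the truncated density, evaluated at the density.
  let a : ℕ → Ω → ℝ := fun n s => f s * Real.log (g n s) + 1 - g n s
  have ham : ∀ n, Measurable (a n) := fun n =>
    ((hfm.mul (hgm n).log).add_const 1).sub (hgm n)
  -- `a = klFun g + (f - g) * log g`, and `f - g` never has the opposite sign of `log g`: the
  -- truncation is active from above only at a level `≥ 1` and from below only at a level `≤ 1`.
  have ha0 : ∀ n s, 0 ≤ a n s := by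
    intro n s
    have hk := klFun_nonneg (hgpos n s).le
    rw [klFun_apply] at hk
    have h1 : 0 ≤ (f s - g n s) * Real.log (g n s) := by
      rcases le_total (f s) (n + 1) with h2 | h2
      · rcases le_total ((n + 1 : ℝ)⁻¹) (f s) with h3 | h3
        · have : g n s = f s := by simp only [g]; rw [min_eq_left h2, max_eq_left h3]
          simp [this]
        · have : g n s = (n + 1 : ℝ)⁻¹ := by simp only [g]; rw [min_eq_left h2, max_eq_right h3]
          rw [this]
          exact mul_nonneg_of_nonpos_of_nonpos (by linarith)
            (Real.log_nonpos (hn0 n).le (hn1 n))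
      · have : g n s = n + 1 := by
          simp only [g]; rw [min_eq_right h2, max_eq_left ((hn1 n).trans (hn2 n))]
        rw [this]
        exact mul_nonneg (by linarith) (Real.log_nonneg (hn2 n))
    have : a n s = (f s - g n s) * Real.log (g n s) + (g n s * Real.log (g n s) + 1 - g n s) := by
      simp only [a]; ring
    rw [this]
    exact add_nonneg h1 hk
  have hlim : ∀ s, Tendsto (fun n => a n s) atTop (𝓝 (klFun (f s))) := by
    intro s
    have hT : Tendsto (fun n => g n s) atTop (𝓝 (f s)) := by
      have h1 : Tendsto (fun n : ℕ => max (f s) ((n + 1 : ℝ)⁻¹)) atTop (𝓝 (max (f s) 0)) :=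
        tendsto_const_nhds.max (by simpa using tendsto_one_div_add_atTop_nhds_zero_nat (𝕜 := ℝ))
      rw [max_eq_left (hf0 s)] at h1
      refine h1.congr' ?_
      obtain ⟨N, hN⟩ := exists_nat_ge (f s)
      filter_upwards [eventually_ge_atTop N] with n hn
      have : f s ≤ n + 1 := by
        have : (N : ℝ) ≤ n := by exact_mod_cast hn
        linarith
      simp only [g]
      rw [min_eq_left this]
    rw [klFun_apply]
    rcases (hf0 s).eq_or_lt with h0 | h0
    · simp only [a]
      rw [← h0] at hT ⊢
      simpa using hT.const_sub 1
    · exact ((((Real.continuousAt_log h0.ne').tendsto.comp hT).const_mul _).add_const 1).sub hT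
  have hbound : ∀ n, ∫⁻ s, ENNReal.ofReal (a n s) ∂ρ ≤ ENNReal.ofReal K := by
    intro n
    have hgi : Integrable (g n) ρ := Integrable.of_bound (C := n + 1)
      (hgm n).aestronglyMeasurable (Eventually.of_forall fun s => by
        rw [Real.norm_eq_abs, abs_of_pos (hgpos n s)]
        exact hg2 n s)
    have hli : Integrable (fun s => Real.log (g n s)) h.measure :=
      Integrable.of_bound (C := Real.log (n + 1)) (hgm n).log.aestronglyMeasurable
        (Eventually.of_forall (hlog n))
    have hfl : Integrable (fun s => f s * Real.log (g n s)) ρ :=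
      (integrable_toReal_rnDeriv_mul_iff hac).2 hli
    have hfl1 : Integrable (fun s => f s * Real.log (g n s) + 1) ρ := hfl.add (integrable_const 1)
    have hai : Integrable (a n) ρ := hfl1.sub hgi
    rw [← ofReal_integral_eq_lintegral_ofReal hai (Eventually.of_forall (ha0 n))]
    refine ENNReal.ofReal_le_ofReal ?_
    have h1 : ∫ s, a n s ∂ρ = ∫ s, Real.log (g n s) ∂h.measure + 1 - ∫ s, g n s ∂ρ := by
      rw [integral_sub hfl1 hgi, integral_add hfl (integrable_const 1),
        integral_toReal_rnDeriv_mul hac]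
      simp
    set Z := ∫ s, g n s ∂ρ with hZ
    have hZpos : 0 < Z := by
      have := integral_mono (integrable_const ((n + 1 : ℝ)⁻¹)) hgi (fun s => hg1 n s)
      simp only [integral_const, probReal_univ, one_smul] at this
      exact (hn0 n).trans_le this
    have h2 : Λ (fun s => Real.log (g n s)) ≤ Real.log Z + K := by
      refine h.le _ (mem_dominatedSubmodule_of_abs_le h.one_le (hgm n).log (hlog n)) _ ?_
      have h3 : ∀ s, Real.exp (Real.log (g n s) - Real.log Z) = g n s / Z := fun s => by
        rw [Real.exp_sub, Real.exp_log (hgpos n s), Real.exp_log hZpos]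
      simp only [h3]
      rw [← ofReal_integral_eq_lintegral_ofReal (hgi.div_const Z)
        (Eventually.of_forall fun s => (div_pos (hgpos n s) hZpos).le), integral_div,
        div_self hZpos.ne', ENNReal.ofReal_one]
    rw [h.apply_eq_integral_of_abs_le (hgm n).log (hlog n)] at h2
    have h3 := Real.log_le_sub_one_of_pos hZpos
    linarith
  calc ∫⁻ s, ENNReal.ofReal (klFun (f s)) ∂ρ
      = ∫⁻ s, liminf (fun n => ENNReal.ofReal (a n s)) atTop ∂ρ :=
        lintegral_congr fun s => (ENNReal.tendsto_ofReal (hlim s)).liminf_eq.symm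
    _ ≤ liminf (fun n => ∫⁻ s, ENNReal.ofReal (a n s) ∂ρ) atTop :=
        lintegral_liminf_le fun n => (ham n).ennreal_ofReal
    _ ≤ ENNReal.ofReal K :=
        liminf_le_of_le (by isBoundedDefault) fun b hb =>
          (hb.exists.choose_spec).trans (hbound _)

end Entropy

/-! ### Sums of extended reals -/

theorem ereal_coe_sum {ι : Type*} (s : Finset ι) (f : ι → ℝ) :
    ((∑ i ∈ s, f i : ℝ) : EReal) = ∑ i ∈ s, (f i : EReal) := by
  classical
  induction s using Finset.induction_on with
  | empty => simp
  | insert i s hi ih => rw [Finset.sum_insert hi, Finset.sum_insert hi, EReal.coe_add, ih]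

theorem ereal_sum_ne_bot {ι : Type*} (s : Finset ι) {f : ι → EReal} (hf : ∀ i, f i ≠ ⊥) :
    ∑ i ∈ s, f i ≠ ⊥ := by
  classical
  induction s using Finset.induction_on with
  | empty => simp
  | insert i s hi ih =>
    rw [Finset.sum_insert hi, Ne, EReal.add_eq_bot_iff]
    simp [hf i, ih]

theorem ereal_ne_top_of_sum_ne_top {ι : Type*} [Fintype ι] {f : ι → EReal} (hf : ∀ i, f i ≠ ⊥)
    (h : ∑ i, f i ≠ ⊤) (i : ι) : f i ≠ ⊤ := by
  classical
  rintro hi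
  rw [← Finset.add_sum_erase _ _ (Finset.mem_univ i), hi,
    EReal.top_add_of_ne_bot (ereal_sum_ne_bot _ hf)] at h
  exact h rfl

theorem conjugate_ne_bot {E : Type*} [NormedAddCommGroup E] [NormedSpace ℝ E] {G : E → EReal}
    (hG : IsProperConvexLsc G) (ℓ : StrongDual ℝ E) : conjugate G ℓ ≠ ⊥ := by
  obtain ⟨x, hx⟩ := hG.exists_ne_top
  have h1 : ((ℓ x : ℝ) : EReal) - G x ≤ conjugate G ℓ :=
    le_iSup (fun y => ((ℓ y : ℝ) : EReal) - G y) x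
  intro hbot
  rw [hbot, le_bot_iff, ← EReal.coe_toReal hx (hG.ne_bot x), ← EReal.coe_sub] at h1
  exact EReal.coe_ne_bot _ h1

/-! ### Functionals represented by measures -/

section Single

variable {X : Type*} [TopologicalSpace X] [MeasurableSpace X] [BorelSpace X]

/-- A signed measure that integrates bounded continuous functions like a probability measure
coincides with it, hence represents the same functional on unbounded functions too. -/
theorem IsSignedMeasure.eq_toDual [HasOuterApproxClosed X] {w : Weight X}
    {ℓ : StrongDual ℝ (WCont w)} (hℓ : IsSignedMeasure ℓ) (p : WProb w)
    (h : ∀ x : WCont w, (∃ M : ℝ, ∀ s, |x s| ≤ M) → ℓ x = ∫ s, x s ∂p.toMeasure) :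
    ℓ = p.toDual := by
  obtain ⟨ν, hν, hνℓ⟩ := hℓ
  have := p.isProb
  set P := ν.toJordanDecomposition.posPart
  set N := ν.toJordanDecomposition.negPart
  have hwP : Integrable w P := hν.mono_measure (Measure.le_add_right le_rfl)
  have hwN : Integrable w N := hν.mono_measure (Measure.le_add_left le_rfl)
  have hPN : p.toMeasure + N = P := by
    refine ext_of_forall_integral_eq_of_IsFiniteMeasure fun f => ?_
    let x : WCont w := ⟨f, f.continuous, ‖f‖, fun s => by
      rw [abs_div, abs_of_pos (w.pos s)]
      exact (div_le_self (abs_nonneg _) (w.one_le s)).trans (f.norm_coe_le_norm s)⟩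
    have h1 : ℓ x = ∫ s, f s ∂p.toMeasure := h x ⟨‖f‖, f.norm_coe_le_norm⟩
    have h2 : ℓ x = ∫ s, f s ∂P - ∫ s, f s ∂N := hνℓ x
    rw [integral_add_measure (f.integrable _) (f.integrable _)]
    linarith
  ext x
  change ℓ x = ∫ s, x s ∂p.toMeasure
  rw [hνℓ x, ← hPN, integral_add_measure (x.integrable p.integrable_weight) (x.integrable hwN)]
  ring

end Single

section Product

variable {T : ℕ} {S : Fin (T + 1) → Type*} [∀ t, TopologicalSpace (S t)] {ψ : ∀ t, Weight (S t)}

theorem weight_le_sumWeight (ψ : ∀ t, Weight (S t)) (t : Fin (T + 1)) (s : ∀ t, S t) :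
    ψ t (s t) ≤ sumWeight ψ s :=
  Finset.single_le_sum (f := fun t => ψ t (s t)) (fun t _ => ((ψ t).pos (s t)).le)
    (Finset.mem_univ t)

variable [∀ t, MeasurableSpace (S t)]

/-! ### Finiteness of the dual value -/

theorem exists_potentialObjective_ne_top {G : ∀ t, WCont (ψ t) → EReal}
    {R : WProb (sumWeight ψ)}
    (hfeas : ∃ x : ∀ t, WCont (ψ t), (∀ t, G t (x t) ≠ ⊤) ∧
      ∃ ε : ℝ, 0 < ε ∧ ∀ s, ε * sumWeight ψ s ≤ ∑ t, x t (s t)) :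
    ∃ x, potentialObjective G R x ≠ ⊤ := by
  have := R.isProb
  obtain ⟨x, hx, ε, hε, hxε⟩ := hfeas
  have hle : ENNReal.log (∫⁻ s, ENNReal.ofReal (Real.exp (-∑ t, x t (s t))) ∂ R.toMeasure) ≤ 0 := by
    rw [ENNReal.log_le_zero_iff]
    calc _ ≤ ∫⁻ _, 1 ∂ R.toMeasure := lintegral_mono fun s => by
          rw [ENNReal.ofReal_le_one, Real.exp_le_one_iff, neg_nonpos]
          exact (mul_nonneg hε.le ((sumWeight ψ).pos s).le).trans (hxε s)
      _ = 1 := by simp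
  have hsum : ∑ t, G t (x t) ≤ ((∑ t, (G t (x t)).toReal : ℝ) : EReal) := by
    rw [ereal_coe_sum]
    exact Finset.sum_le_sum fun t _ => EReal.le_coe_toReal (hx t)
  refine ⟨x, ne_top_of_le_ne_top (EReal.coe_ne_top (∑ t, (G t (x t)).toReal)) ?_⟩
  simpa using! add_le_add hsum hle

variable [∀ t, BorelSpace (S t)]

/-! ### Dominated functions on the product -/

theorem WCont.measurable_comp_eval {t : Fin (T + 1)} (x : WCont (ψ t)) :
    Measurable fun s : ∀ t, S t => x (s t) :=
  x.continuous.measurable.comp (measurable_pi_apply t)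

theorem WCont.comp_eval_mem {t : Fin (T + 1)} (x : WCont (ψ t)) :
    (fun s => x (s t)) ∈ dominatedSubmodule (sumWeight ψ) :=
  ⟨x.measurable_comp_eval, ‖x‖, fun s => (x.abs_apply_le (s t)).trans
    (mul_le_mul_of_nonneg_left (weight_le_sumWeight ψ t s) (norm_nonneg x))⟩

theorem weight_comp_eval_mem (t : Fin (T + 1)) :
    (fun s => ψ t (s t)) ∈ dominatedSubmodule (sumWeight ψ) :=
  ⟨(ψ t).continuous_toFun.measurable.comp (measurable_pi_apply t), 1, fun s => by
    rw [abs_of_pos ((ψ t).pos _), one_mul]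
    exact weight_le_sumWeight ψ t s⟩

theorem sumWeight_mem : (sumWeight ψ : (∀ t, S t) → ℝ) ∈ dominatedSubmodule (sumWeight ψ) := by
  have := Submodule.sum_mem (dominatedSubmodule (sumWeight ψ))
    (fun t (_ : t ∈ Finset.univ) => weight_comp_eval_mem (ψ := ψ) t)
  convert this using 1
  ext s
  rw [Finset.sum_apply]
  rfl

theorem sum_comp_eval_mem (x : ∀ t, WCont (ψ t)) :
    (fun s => ∑ t, x t (s t)) ∈ dominatedSubmodule (sumWeight ψ) := by
  have := Submodule.sum_mem (dominatedSubmodule (sumWeight ψ))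
    (fun t (_ : t ∈ Finset.univ) => (x t).comp_eval_mem)
  convert this using 1
  ext s
  rw [Finset.sum_apply]

theorem WProb.integrable_comp_eval (p : WProb (sumWeight ψ)) {t : Fin (T + 1)} (x : WCont (ψ t)) :
    Integrable (fun s => x (s t)) p.toMeasure := by
  refine (p.integrable_weight.const_mul ‖x‖).mono' x.measurable_comp_eval.aestronglyMeasurable ?_
  exact Eventually.of_forall x.comp_eval_mem.2.choose_spec |>.mono fun s _ =>
    (x.abs_apply_le (s t)).trans
      (mul_le_mul_of_nonneg_left (weight_le_sumWeight ψ t s) (norm_nonneg x))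

/-! ### Separation for the dual problem -/

/-- The epigraph of the log-moment generating function is separated from the hypograph of
`v - ∑ t, G t`, for a lower bound `v` of the potential objective. The number `-v` is split into an
entropy bound `K` and bounds `b t` on the conjugates of `G t` at `x ↦ Λ (x ∘ eval t)`. -/
theorem exists_isEntropic {G : ∀ t, WCont (ψ t) → EReal} (hG : ∀ t, IsProperConvexLsc (G t))
    {R : WProb (sumWeight ψ)}
    (hfeas : ∃ x : ∀ t, WCont (ψ t), (∀ t, G t (x t) ≠ ⊤) ∧
      ∃ ε : ℝ, 0 < ε ∧ ∀ s, ε * sumWeight ψ s ≤ ∑ t, x t (s t))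
    {v : ℝ} (hv : ∀ x, (v : EReal) ≤ potentialObjective G R x) :
    ∃ (Λ : ((∀ t, S t) → ℝ) →ₗ[ℝ] ℝ) (K : ℝ) (b : Fin (T + 1) → ℝ),
      IsEntropic (sumWeight ψ) R.toMeasure K Λ ∧ ∑ t, b t = -v - K ∧
      ∀ t (x : WCont (ψ t)), ((Λ fun s => x (s t) : ℝ) : EReal) - G t x ≤ b t := by
  have := R.isProb
  let Y := dominatedSubmodule (sumWeight ψ : (∀ t, S t) → ℝ)
  -- The pairs `(u, r)` range over the reflected epigraph of the log-moment generating function, and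
  -- `(x, γ)` over the epigraphs of the `G t`.
  let C : Set (((∀ t, S t) → ℝ) × ℝ) := {z | ∃ u ∈ Y, ∃ r : ℝ, ∃ x : ∀ t, WCont (ψ t),
    ∃ γ : Fin (T + 1) → ℝ,
      lintegral R.toMeasure (fun s => ENNReal.ofReal (Real.exp (u s - r))) ≤ 1 ∧
      (∀ t, G t (x t) ≤ γ t) ∧ z = (fun s => -u s - ∑ t, x t (s t), r + ∑ t, γ t - v)}
  have hC : Convex ℝ C := by
    rw [convex_iff_forall_pos]
    rintro _ ⟨u, hu, r, x, γ, h1, h2, rfl⟩ _ ⟨u', hu', r', x', γ', h1', h2', rfl⟩ a b ha hb hab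
    refine ⟨a • u + b • u', Y.add_mem (Y.smul_mem a hu) (Y.smul_mem b hu'), a * r + b * r',
      fun t => a • x t + b • x' t, fun t => a * γ t + b * γ' t, ?_, fun t => ?_, ?_⟩
    · have hm : Measurable u := hu.1
      have hm' : Measurable u' := hu'.1
      calc lintegral R.toMeasure
            (fun s => ENNReal.ofReal (Real.exp ((a • u + b • u') s - (a * r + b * r'))))
          ≤ lintegral R.toMeasure (fun s => ENNReal.ofReal a * ENNReal.ofReal (Real.exp (u s - r))
              + ENNReal.ofReal b * ENNReal.ofReal (Real.exp (u' s - r'))) := by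
            refine lintegral_mono fun s => ?_
            rw [← ENNReal.ofReal_mul ha.le, ← ENNReal.ofReal_mul hb.le,
              ← ENNReal.ofReal_add (by positivity) (by positivity)]
            refine ENNReal.ofReal_le_ofReal ?_
            have := convexOn_exp.2 (mem_univ (u s - r)) (mem_univ (u' s - r')) ha.le hb.le hab
            simp only [smul_eq_mul] at this
            refine le_trans (le_of_eq ?_) this
            congr 1
            simp only [Pi.add_apply, Pi.smul_apply, smul_eq_mul]
            ring
        _ = ENNReal.ofReal a * lintegral R.toMeasure (fun s => ENNReal.ofReal (Real.exp (u s - r)))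
            + ENNReal.ofReal b
              * lintegral R.toMeasure (fun s => ENNReal.ofReal (Real.exp (u' s - r'))) := by
            rw [lintegral_add_left (by fun_prop), lintegral_const_mul _ (by fun_prop),
              lintegral_const_mul _ (by fun_prop)]
        _ ≤ ENNReal.ofReal a * 1 + ENNReal.ofReal b * 1 := by gcongr
        _ = 1 := by rw [mul_one, mul_one, ← ENNReal.ofReal_add ha.le hb.le, hab, ENNReal.ofReal_one]
    · refine ((hG t).convex _ _ a b ha hb hab).trans ?_
      rw [EReal.coe_add, EReal.coe_mul, EReal.coe_mul]
      exact add_le_add (mul_le_mul_of_nonneg_left (h2 t) (by exact_mod_cast ha.le))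
        (mul_le_mul_of_nonneg_left (h2' t) (by exact_mod_cast hb.le))
    · refine Prod.ext (funext fun s => ?_) ?_
      · simp only [Prod.fst_add, Prod.smul_fst, Pi.add_apply, Pi.smul_apply, smul_eq_mul,
          WCont.add_apply, WCont.smul_apply, Finset.sum_add_distrib, ← Finset.mul_sum]
        ring
      · simp only [Prod.snd_add, Prod.smul_snd, smul_eq_mul, Finset.sum_add_distrib,
          ← Finset.mul_sum]
        linear_combination -v * hab
  have h0 : ∀ a : ℝ, ((0 : (∀ t, S t) → ℝ), a) ∈ C → 0 ≤ a := by
    rintro a ⟨u, hu, r, x, γ, h1, h2, h3⟩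
    rw [Prod.mk.injEq] at h3
    obtain ⟨h3, rfl⟩ := h3
    have hux : ∀ s, -∑ t, x t (s t) = u s := fun s => by
      have := congrFun h3 s
      simp only [Pi.zero_apply] at this
      linarith
    have hlog : ENNReal.log (lintegral R.toMeasure
        fun s => ENNReal.ofReal (Real.exp (-∑ t, x t (s t)))) ≤ r := by
      have hle : (lintegral R.toMeasure fun s => ENNReal.ofReal (Real.exp (-∑ t, x t (s t))))
          ≤ ENNReal.ofReal (Real.exp r) := by
        calc (lintegral R.toMeasure fun s => ENNReal.ofReal (Real.exp (-∑ t, x t (s t))))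
            = lintegral R.toMeasure
                fun s => ENNReal.ofReal (Real.exp r) * ENNReal.ofReal (Real.exp (u s - r)) := by
              refine lintegral_congr fun s => ?_
              rw [hux, ← ENNReal.ofReal_mul (Real.exp_pos r).le, ← Real.exp_add]
              congr 2
              ring
          _ ≤ ENNReal.ofReal (Real.exp r) := by
              have hm : Measurable u := hu.1
              rw [lintegral_const_mul _ (by fun_prop)]
              exact mul_le_of_le_one_right' h1
      refine (ENNReal.log_monotone hle).trans_eq ?_
      rw [ENNReal.log_ofReal_of_pos (Real.exp_pos r), Real.log_exp]
    have h4 : (v : EReal) ≤ ((∑ t, γ t + r : ℝ) : EReal) := by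
      rw [EReal.coe_add, ereal_coe_sum]
      exact (hv x).trans (add_le_add (Finset.sum_le_sum fun t _ => h2 t) hlog)
    have := EReal.coe_le_coe_iff.1 h4
    linarith
  obtain ⟨x₀, hx₀, ε, hε, hx₀ε⟩ := hfeas
  have habs : ∀ y ∈ Y, ∃ c : ℝ, 0 < c ∧ ∃ a : ℝ, (c • y, a) ∈ C := by
    rintro y ⟨hym, M, hM⟩
    -- For `c = ε / (|M| + 1)` the function `-∑ t, x₀ t - c * y` is nonpositive, so `r = 0` works.
    have hMpos : 0 < |M| + 1 := by positivity
    refine ⟨ε / (|M| + 1), by positivity, 0 + ∑ t, (G t (x₀ t)).toReal - v, -(fun s => ∑ t, x₀ t (s t)) - (ε / (|M| + 1)) • y,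
      Y.sub_mem (Y.neg_mem (sum_comp_eval_mem x₀)) (Y.smul_mem _ ⟨hym, M, hM⟩), 0, x₀,
      fun t => (G t (x₀ t)).toReal, ?_, fun t => EReal.le_coe_toReal (hx₀ t), ?_⟩
    · calc _ ≤ lintegral R.toMeasure fun _ => 1 := by
            refine lintegral_mono fun s => ?_
            rw [ENNReal.ofReal_le_one, Real.exp_le_one_iff]
            simp only [Pi.sub_apply, Pi.neg_apply, Pi.smul_apply, smul_eq_mul, sub_zero]
            have hw := (sumWeight ψ).pos s
            have h1 : -y s ≤ (|M| + 1) * sumWeight ψ s :=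
              (neg_le_abs _).trans ((hM s).trans (mul_le_mul_of_nonneg_right
                ((le_abs_self M).trans (by linarith)) hw.le))
            have h2 := mul_le_mul_of_nonneg_left h1 (by positivity : 0 ≤ ε / (|M| + 1))
            rw [← mul_assoc, div_mul_cancel₀ _ hMpos.ne'] at h2
            linarith [hx₀ε s]
        _ = 1 := by simp
    · refine Prod.ext (funext fun s => ?_) rfl
      simp
  obtain ⟨Λ, hΛ⟩ := exists_linearMap_nonneg_of_convex Y hC h0 habs
  let B : Fin (T + 1) → Set ℝ := fun t =>
    {β | ∃ (x : WCont (ψ t)) (γ : ℝ), G t x ≤ γ ∧ β = (Λ fun s => x (s t)) - γ}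
  have hBne : ∀ t, (B t).Nonempty := fun t =>
    ⟨_, x₀ t, (G t (x₀ t)).toReal, EReal.le_coe_toReal (hx₀ t), rfl⟩
  have key : ∀ u ∈ Y, ∀ r : ℝ,
      lintegral R.toMeasure (fun s => ENNReal.ofReal (Real.exp (u s - r))) ≤ 1 →
      ∀ β : Fin (T + 1) → ℝ, (∀ t, β t ∈ B t) → ∑ t, β t ≤ r - v - Λ u := by
    intro u hu r hr β hβ
    choose x γ hγ hβ using hβ
    have h1 := hΛ (fun s => -u s - ∑ t, x t (s t))
      (Y.sub_mem (Y.neg_mem hu) (sum_comp_eval_mem x)) _ ⟨u, hu, r, x, γ, hr, hγ, rfl⟩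
    have h2 : (fun s => -u s - ∑ t, x t (s t)) = -u - ∑ t, fun s : ∀ t, S t => x t (s t) := by
      ext s
      simp
    rw [h2, map_sub, map_neg, map_sum] at h1
    simp only [hβ, Finset.sum_sub_distrib]
    linarith
  have hB := (bddAbove_and_sum_csSup_le hBne (key 0 Y.zero_mem 0 (by simp))).1
  refine ⟨Λ, -v - ∑ t, sSup (B t), fun t => sSup (B t), ⟨(sumWeight ψ).one_le, fun u hu r hr => ?_⟩,
    by ring, fun t x => ?_⟩
  · have := (bddAbove_and_sum_csSup_le hBne (key u hu r hr)).2
    linarith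
  · by_cases hx : G t x = ⊤
    · simp [hx]
    · rw [← EReal.coe_toReal hx ((hG t).ne_bot x), ← EReal.coe_sub, EReal.coe_le_coe_iff]
      exact le_csSup (hB t) ⟨x, _, EReal.le_coe_toReal hx, rfl⟩

variable [∀ t, PolishSpace (S t)]

theorem WProb.marginal_toDual_apply (p : WProb (sumWeight ψ)) (t : Fin (T + 1)) (x : WCont (ψ t)) :
    (p.marginal t).toDual x = ∫ s, x (s t) ∂p.toMeasure :=
  integral_map (measurable_pi_apply t).aemeasurable x.continuous.aestronglyMeasurable

/-! ### Weak duality -/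

theorem neg_potentialObjective_le_schrodingerObjective {G : ∀ t, WCont (ψ t) → EReal}
    (hG : ∀ t, IsProperConvexLsc (G t)) {R q : WProb (sumWeight ψ)}
    (hq : q.toMeasure ≪ R.toMeasure) (x : ∀ t, WCont (ψ t)) :
    -potentialObjective G R x ≤ schrodingerObjective G R q := by
  have := R.isProb
  have := q.isProb
  by_cases hpot : potentialObjective G R x = ⊤
  · simp [hpot]
  by_cases hkl : klDiv q.toMeasure R.toMeasure = ⊤
  · rw [schrodingerObjective, hkl, EReal.coe_ennreal_top,
      EReal.add_top_of_ne_bot (ereal_sum_ne_bot _ fun t => conjugate_ne_bot (hG t) _)]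
    exact le_top
  rw [potentialObjective] at hpot ⊢
  set Z := lintegral R.toMeasure fun s => ENNReal.ofReal (Real.exp (-∑ t, x t (s t))) with hZ
  have hmeas : Measurable fun s : ∀ t, S t => -∑ t, x t (s t) := (sum_comp_eval_mem x).1.neg
  have hZ0 : Z ≠ 0 := by
    rw [hZ, Ne, lintegral_eq_zero_iff (by fun_prop)]
    intro h0
    obtain ⟨s, hs⟩ := h0.exists
    simp only [Pi.zero_apply, ENNReal.ofReal_eq_zero] at hs
    exact absurd hs (not_le.2 (Real.exp_pos _))
  have hlog : ENNReal.log Z ≠ ⊥ := by simpa using hZ0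
  have hsum : ∑ t, G t (x t) ≠ ⊥ := ereal_sum_ne_bot _ fun t => (hG t).ne_bot _
  have hZtop : Z ≠ ⊤ := fun h => hpot (by
    rw [h, ENNReal.log_top, EReal.add_top_of_ne_bot hsum])
  have hGtop : ∀ t, G t (x t) ≠ ⊤ := ereal_ne_top_of_sum_ne_top (fun t => (hG t).ne_bot _)
    fun h => hpot (by rw [h, EReal.top_add_of_ne_bot hlog])
  have hexp : Integrable (fun s => Real.exp (-∑ t, x t (s t))) R.toMeasure :=
    (lintegral_ofReal_ne_top_iff_integrable hmeas.exp.aestronglyMeasurable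
      (Eventually.of_forall fun s => (Real.exp_pos _).le)).1 hZtop
  have hZeq : ENNReal.log Z = (Real.log (∫ s, Real.exp (-∑ t, x t (s t)) ∂ R.toMeasure) : ℝ) := by
    rw [hZ, ← ofReal_integral_eq_lintegral_ofReal hexp
      (Eventually.of_forall fun s => (Real.exp_pos _).le),
      ENNReal.log_ofReal_of_pos (integral_exp_pos hexp)]
  have hconj : ((∑ t, ((q.marginal t).toDual (x t) - (G t (x t)).toReal) : ℝ) : EReal)
      ≤ ∑ t, conjugate (G t) (q.marginal t).toDual := by
    rw [ereal_coe_sum]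
    refine Finset.sum_le_sum fun t _ => ?_
    rw [EReal.coe_sub, EReal.coe_toReal (hGtop t) ((hG t).ne_bot _)]
    exact le_iSup (fun y => (((q.marginal t).toDual y : ℝ) : EReal) - G t y) (x t)
  have hdv := integral_sub_log_integral_exp_le_klDiv hq hkl
    (integrable_finsetSum Finset.univ fun t _ => q.integrable_comp_eval (x t)).neg hexp
  simp only [Pi.neg_apply] at hdv
  rw [integral_neg, integral_finsetSum _ fun t _ => q.integrable_comp_eval (x t)] at hdv
  rw [schrodingerObjective, ← ENNReal.ofReal_toReal hkl, EReal.coe_ennreal_ofReal,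
    max_eq_left ENNReal.toReal_nonneg]
  refine le_trans ?_ (add_le_add_left hconj _)
  have hGsum : ∑ t, G t (x t) = ((∑ t, (G t (x t)).toReal : ℝ) : EReal) := by
    rw [ereal_coe_sum]
    exact Finset.sum_congr rfl fun t _ => (EReal.coe_toReal (hGtop t) ((hG t).ne_bot _)).symm
  rw [hGsum, hZeq, ← EReal.coe_add, ← EReal.coe_neg, ← EReal.coe_add, EReal.coe_le_coe_iff,
    Finset.sum_sub_distrib]
  simp only [WProb.marginal_toDual_apply]
  linarith

theorem neg_iInf_potentialObjective_le_schrodingerObjective {G : ∀ t, WCont (ψ t) → EReal}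
    (hG : ∀ t, IsProperConvexLsc (G t)) {R q : WProb (sumWeight ψ)}
    (hq : q.toMeasure ≪ R.toMeasure) :
    -⨅ x, potentialObjective G R x ≤ schrodingerObjective G R q :=
  EReal.neg_le_of_neg_le (le_iInf fun x =>
    EReal.neg_le_of_neg_le (neg_potentialObjective_le_schrodingerObjective hG hq x))

/-! ### Strong duality -/

/-- The witness is the measure of the entropic functional. Its marginals are identified with the
functional on each `C_t` by order continuity under finite exponential moments, and otherwise by
comparison with a signed measure on bounded continuous functions. -/
theorem exists_schrodingerObjective_le {G : ∀ t, WCont (ψ t) → EReal}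
    (hG : ∀ t, IsProperConvexLsc (G t)) {R : WProb (sumWeight ψ)}
    (hdom : ∀ t,
      (∀ c : ℝ, Integrable (fun s => Real.exp (c * ψ t (s t))) R.toMeasure) ∨
      (∀ ℓ : StrongDual ℝ (WCont (ψ t)), conjugate (G t) ℓ ≠ ⊤ → IsSignedMeasure ℓ))
    (hfeas : ∃ x : ∀ t, WCont (ψ t), (∀ t, G t (x t) ≠ ⊤) ∧
      ∃ ε : ℝ, 0 < ε ∧ ∀ s, ε * sumWeight ψ s ≤ ∑ t, x t (s t))
    {v : ℝ} (hv : ∀ x, (v : EReal) ≤ potentialObjective G R x) :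
    ∃ p : WProb (sumWeight ψ), p.toMeasure ≪ R.toMeasure ∧ schrodingerObjective G R p ≤ -v := by
  have := R.isProb
  obtain ⟨Λ, K, b, hΛ, hb, hconj⟩ := exists_isEntropic hG hfeas hv
  let p : WProb (sumWeight ψ) := ⟨hΛ.measure, inferInstance, hΛ.integrable sumWeight_mem⟩
  have hp : ∀ t, conjugate (G t) (p.marginal t).toDual ≤ b t := by
    intro t
    let ℓ : StrongDual ℝ (WCont (ψ t)) := LinearMap.mkContinuous
      { toFun := fun x => Λ fun s => x (s t)
        map_add' := fun x y => Λ.map_add (fun s => x (s t)) (fun s => y (s t))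
        map_smul' := fun c x => Λ.map_smul c (fun s => x (s t)) }
      (Λ fun s => ψ t (s t)) (fun x => by
        have h1 := hΛ.abs_apply_le x.comp_eval_mem
          (Submodule.smul_mem _ ‖x‖ (weight_comp_eval_mem t)) fun s => x.abs_apply_le (s t)
        rw [map_smul, smul_eq_mul, mul_comm] at h1
        exact h1)
    have hℓ : conjugate (G t) ℓ ≤ b t := iSup_le fun x => hconj t x
    suffices h : ℓ = (p.marginal t).toDual by rwa [← h]
    rcases hdom t with ha | hb'
    · ext x
      rw [WProb.marginal_toDual_apply]
      refine hΛ.apply_eq_integral x.comp_eval_mem fun c => ?_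
      have hm := x.measurable_comp_eval
      refine (ha (|c| * ‖x‖)).mono'
        (hm.abs.const_mul c).exp.aestronglyMeasurable (Eventually.of_forall fun s => ?_)
      rw [Real.norm_eq_abs, Real.abs_exp, Real.exp_le_exp, mul_assoc]
      exact (mul_le_mul_of_nonneg_right (le_abs_self c) (abs_nonneg _)).trans
        (mul_le_mul_of_nonneg_left (x.abs_apply_le (s t)) (abs_nonneg c))
    · refine (hb' ℓ (ne_top_of_le_ne_top (EReal.coe_ne_top _) hℓ)).eq_toDual _ ?_
      rintro x ⟨M, hM⟩
      exact (hΛ.apply_eq_integral_of_abs_le x.measurable_comp_eval fun s => hM (s t)).trans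
        (p.marginal_toDual_apply t x).symm
  refine ⟨p, hΛ.measure_absolutelyContinuous, ?_⟩
  calc schrodingerObjective G R p
      ≤ ∑ t, (b t : EReal) + ((ENNReal.ofReal K : ENNReal) : EReal) :=
        add_le_add (Finset.sum_le_sum fun t _ => hp t)
          (EReal.coe_ennreal_le_coe_ennreal_iff.2 hΛ.klDiv_measure_le)
    _ = -v := by
        rw [← ereal_coe_sum, hb, EReal.coe_ennreal_ofReal, max_eq_left hΛ.const_nonneg,
          ← EReal.coe_add, ← EReal.coe_neg]
        congr 1
        ring

theorem exists_schrodingerObjective_le_neg_iInf {G : ∀ t, WCont (ψ t) → EReal}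
    (hG : ∀ t, IsProperConvexLsc (G t)) {R : WProb (sumWeight ψ)}
    (hdom : ∀ t,
      (∀ c : ℝ, Integrable (fun s => Real.exp (c * ψ t (s t))) R.toMeasure) ∨
      (∀ ℓ : StrongDual ℝ (WCont (ψ t)), conjugate (G t) ℓ ≠ ⊤ → IsSignedMeasure ℓ))
    (hfeas : ∃ x : ∀ t, WCont (ψ t), (∀ t, G t (x t) ≠ ⊤) ∧
      ∃ ε : ℝ, 0 < ε ∧ ∀ s, ε * sumWeight ψ s ≤ ∑ t, x t (s t)) :
    ∃ p : WProb (sumWeight ψ), p.toMeasure ≪ R.toMeasure ∧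
      schrodingerObjective G R p ≤ -⨅ x, potentialObjective G R x := by
  rcases eq_or_ne (⨅ x, potentialObjective G R x) ⊥ with hbot | hbot
  -- The bound is `⊤` here, so any feasible measure will do.
  · exact ⟨R, Measure.AbsolutelyContinuous.rfl, by simp [hbot]⟩
  have htop : ⨅ x, potentialObjective G R x ≠ ⊤ := by
    obtain ⟨x, hx⟩ := exists_potentialObjective_ne_top hfeas
    exact ne_top_of_le_ne_top hx (iInf_le _ x)
  have := exists_schrodingerObjective_le hG hdom hfeas
    (v := (⨅ x, potentialObjective G R x).toReal) fun x => by
      rw [EReal.coe_toReal htop hbot]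
      exact iInf_le _ x
  rwa [EReal.coe_toReal htop hbot] at this

end Product

end Schrodinger

theorem mainTheorem12 {T : ℕ} {S : Fin (T + 1) → Type*} [∀ t, TopologicalSpace (S t)]
    [∀ t, PolishSpace (S t)] [∀ t, MeasurableSpace (S t)] [∀ t, BorelSpace (S t)]
    (ψ : ∀ t, Schrodinger.Weight (S t))
    (R : Schrodinger.WProb (Schrodinger.sumWeight ψ))
    (G : ∀ t, Schrodinger.WCont (ψ t) → EReal)
    (hG : ∀ t, Schrodinger.IsProperConvexLsc (G t))
    (hdom : ∀ t,
      (∀ c : ℝ, Integrable (fun s => Real.exp (c * ψ t (s t))) R.toMeasure) ∨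
      (∀ ℓ : StrongDual ℝ (Schrodinger.WCont (ψ t)),
        Schrodinger.conjugate (G t) ℓ ≠ ⊤ → Schrodinger.IsSignedMeasure ℓ))
    (hfeas : ∃ x : ∀ t, Schrodinger.WCont (ψ t), (∀ t, G t (x t) ≠ ⊤) ∧
      ∃ ε : ℝ, 0 < ε ∧ ∀ s, ε * Schrodinger.sumWeight ψ s ≤ ∑ t, x t (s t)) :
    (∃ p : Schrodinger.WProb (Schrodinger.sumWeight ψ), p.toMeasure ≪ R.toMeasure ∧
      ∀ q : Schrodinger.WProb (Schrodinger.sumWeight ψ), q.toMeasure ≪ R.toMeasure →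
        Schrodinger.schrodingerObjective G R p ≤ Schrodinger.schrodingerObjective G R q) ∧
    (⨅ p : {p : Schrodinger.WProb (Schrodinger.sumWeight ψ) // p.toMeasure ≪ R.toMeasure},
        Schrodinger.schrodingerObjective G R p.1)
      = -⨅ x : ∀ t, Schrodinger.WCont (ψ t), Schrodinger.potentialObjective G R x := by
  obtain ⟨p, hp, hpV⟩ := Schrodinger.exists_schrodingerObjective_le_neg_iInf hG hdom hfeas
  refine ⟨⟨p, hp, fun q hq => hpV.trans
    (Schrodinger.neg_iInf_potentialObjective_le_schrodingerObjective hG hq)⟩, le_antisymm ?_ ?_⟩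
  · exact iInf_le_of_le ⟨p, hp⟩ hpV
  · exact le_iInf fun q =>
      Schrodinger.neg_iInf_potentialObjective_le_schrodingerObjective hG q.2
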